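/- Let $d\ge 1$, let $\mathcal C\in\mathbb R^{d\times d}$ be symmetric positive definite, let $M$ and $m$ be the largest and smallest eigenvalues of $\mathcal C^{-1}$, let $\kappa=M/m$, and put $|x|_{\mathcal C^{-1/2}}=|\mathcal C^{-1/2}x|$. Let $\pi$ be the Hit-and-Run transition kernel with target $\mathcal N(0,\mathcal C)$ on $\mathbb R^d$: writing $\gamma$ for the Lebesgue density of $\mathcal N(0,\mathcal C)$ and $\sigma$ for the uniform distribution on the unit sphere $\mathbb S^{d-1}$, $$\pi(x,A)=\int_{\mathbb S^{d-1}}\int_{\mathbb R}1_A(x+hv)\,\frac{\gamma(x+hv)}{\int_{\mathbb R}\gamma(x+sv)\,ds}\,dh\,\sigma(dv).$$ For $\epsilon\in(0,1)$ and $x\in\mathbb R^d$ let $$C_1(x)=\epsilon^{-1}m^{-1/2}|x|_{\mathcal C^{-1/2}}+2\epsilon M^{1/2}+1,$$ $$C_2(x)=2\epsilon^{-1}m^{-1/2}|x|_{\mathcal C^{-1/2}}^2+2|x|_{\mathcal C^{-1/2}}+\bigl(\epsilon^{-1}m^{-1/2}+2\epsilon\kappa^{1/2}\bigr)(d-1)+2\epsilon^{-1}m^{-1/2}+\bigl(M^{1/2}+m^{-1/2}+2\bigr)\kappa^{1/2},$$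 $$C_3(x)=\sqrt3\,M^{1/4}|x|_{\mathcal C^{-1/2}}+\sqrt2\,(1+\log\epsilon^{-1})^{1/2}M^{1/4}\sqrt{d-1}+\sqrt2\,M^{1/4}\bigl(M^{1/2}+m^{-1/2}+2\bigr)^{1/2}.$$ Let $\mathsf{TV}(\eta,\nu)=2\sup_A|\eta(A)-\nu(A)|$ be the total variation norm of $\eta-\nu$ (the bound below therefore also holds for $\sup_A|\eta(A)-\nu(A)|$), and let $$W(\eta,\nu)=\Bigl(\inf_P\int|x-\tilde x|_{\mathcal C^{-1/2}}^2\,P(dx\,d\tilde x)\Bigr)^{1/2}\in[0,\infty],$$ with the infimum over all couplings $P$ of $\eta$ and $\nu$, be the $L^2$-Wasserstein distance with respect to $|\cdot|_{\mathcal C^{-1/2}}$. Then for every $\epsilon\in(0,1)$ and all Borel probability measures $\eta,\nu$ on $\mathbb R^d$, $$\mathsf{TV}(\eta\pi,\nu\pi)\le\sqrt2\Bigl(\eta(C_1)^{1/2}\,W(\eta,\nu)+\eta(C_2)^{1/2}\,W(\eta,\nu)^{1/2}+\eta(C_3)\,\epsilon^{1/2}\Bigr),$$ where $\eta\pi=\int\pi(x,\cdot)\,\eta(dx)$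 and $\eta(C_i)=\int C_i\,d\eta\in[0,\infty]$, and the right-hand side is computed in $[0,\infty]$ with $0\cdot\infty=0$. -/

import Mathlib

open MeasureTheory ProbabilityTheory
open scoped ENNReal MatrixOrder

noncomputable section

namespace HitAndRun

/-- The state space `ℝᵈ` with its Euclidean norm. -/
abbrev E (d : ℕ) : Type := EuclideanSpace ℝ (Fin d)

/-- The unit sphere `𝕊^{d-1}` of `ℝᵈ`. -/
abbrev S (d : ℕ) : Type := Metric.sphere (0 : E d) 1

/-- The uniform distribution on the unit sphere: the surface measure, normalized to mass one. -/
def unifSphere (d : ℕ) : Measure (S d) :=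
  ((volume : Measure (E d)).toSphere Set.univ)⁻¹ • (volume : Measure (E d)).toSphere

/-- For a density `f` on `ℝᵈ`, the displacement measure on `ℝ` at the point `x` in the direction
`v`, with Lebesgue density `h ↦ f (x + h v) / ∫ f (x + s v) ds`. -/
def displacement {d : ℕ} (f : E d → ℝ) (x v : E d) : Measure ℝ :=
  volume.withDensity fun h =>
    ENNReal.ofReal (f (x + h • v)) / ∫⁻ s : ℝ, ENNReal.ofReal (f (x + s • v))

/-- The conditional distribution on the line `x + ℝ v`: the image of the displacement measure
under `h ↦ x + h v`. -/
def lineLaw {d : ℕ} (f : E d → ℝ) (x v : E d) : Measure (E d) :=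
  (displacement f x v).map fun h => x + h • v

theorem measurable_lineLaw {d : ℕ} {f : E d → ℝ} (hf : Measurable f) :
    Measurable fun p : E d × S d => lineLaw f p.1 p.2 := by
  refine Measure.measurable_of_measurable_coe _ fun A hA => ?_
  have key : ∀ p : E d × S d, lineLaw f p.1 p.2 A = ∫⁻ h : ℝ,
      (A.indicator 1 (p.1 + h • (p.2 : E d)) : ℝ≥0∞) *
      (ENNReal.ofReal (f (p.1 + h • (p.2 : E d))) /
        ∫⁻ s : ℝ, ENNReal.ofReal (f (p.1 + s • (p.2 : E d)))) := by
    intro p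
    have hm : Measurable fun h : ℝ => p.1 + h • (p.2 : E d) := by fun_prop
    rw [lineLaw, Measure.map_apply hm hA, displacement, withDensity_apply _ (hm hA),
      ← lintegral_indicator (hm hA)]
    refine lintegral_congr fun h => ?_
    by_cases h1 : p.1 + h • (p.2 : E d) ∈ A <;> simp [Set.indicator, h1]
  simp_rw [key]
  have hm : Measurable fun q : (E d × S d) × ℝ => q.1.1 + q.2 • (q.1.2 : E d) := by fun_prop
  have hZ : Measurable fun p : E d × S d =>
      ∫⁻ s : ℝ, ENNReal.ofReal (f (p.1 + s • (p.2 : E d))) :=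
    Measurable.lintegral_prod_right' (f := fun q : (E d × S d) × ℝ =>
      ENNReal.ofReal (f (q.1.1 + q.2 • (q.1.2 : E d)))) (hf.comp hm).ennreal_ofReal
  refine Measurable.lintegral_prod_right' (f := fun q : (E d × S d) × ℝ =>
      (A.indicator 1 (q.1.1 + q.2 • (q.1.2 : E d)) : ℝ≥0∞) *
      (ENNReal.ofReal (f (q.1.1 + q.2 • (q.1.2 : E d))) /
        ∫⁻ s : ℝ, ENNReal.ofReal (f (q.1.1 + s • (q.1.2 : E d))))) ?_
  refine Measurable.mul ((measurable_one.indicator hA).comp hm) ?_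
  exact (hf.comp hm).ennreal_ofReal.div (hZ.comp measurable_fst)

/-- The transition kernel of Hit-and-Run for the target density `f`: draw a uniform direction `v`,
then draw the next state from the target conditioned on the line `x + ℝ v`. -/
def kernel {d : ℕ} (f : E d → ℝ) (hf : Measurable f) : Kernel (E d) (E d) where
  toFun x := (unifSphere d).bind fun v => lineLaw f x v
  measurable' := by
    have h : (fun x : E d => (unifSphere d).bind fun v => lineLaw f x v) =
        fun x => ((unifSphere d).map (Prod.mk x)).bind
          fun p : E d × S d => lineLaw f p.1 p.2 := by
      funext x
      ext A hA
      have h1 := measurable_lineLaw hf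
      rw [Measure.bind_apply hA h1.aemeasurable,
        Measure.bind_apply (f := fun v : S d => lineLaw f x v) hA
          (h1.comp measurable_prodMk_left).aemeasurable,
        lintegral_map (f := fun p : E d × S d => lineLaw f p.1 p.2 A)
          ((Measure.measurable_coe hA).comp h1) measurable_prodMk_left]
    rw [h]
    have : IsFiniteMeasure (unifSphere d) := by
      by_cases h0 : (volume : Measure (E d)).toSphere Set.univ = 0
      · have : (volume : Measure (E d)).toSphere = 0 := Measure.measure_univ_eq_zero.1 h0
        rw [unifSphere, this, smul_zero]
        infer_instance
      · exact Measure.smul_finite _ (ENNReal.inv_ne_top.2 h0)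
    exact (Measure.measurable_bind' (measurable_lineLaw hf)).comp Measurable.map_prodMk_left

/-- The norm `|x|_{C^{-1/2}} = |C^{-1/2} x|`, where `C^{-1/2}` is the positive semidefinite square
root of `C⁻¹`. -/
def normC {d : ℕ} (C : Matrix (Fin d) (Fin d) ℝ) (x : E d) : ℝ :=
  ‖Matrix.toEuclideanCLM (𝕜 := ℝ) (CFC.sqrt C⁻¹) x‖

theorem measurable_normC {d : ℕ} (C : Matrix (Fin d) (Fin d) ℝ) : Measurable (normC C) :=
  (Matrix.toEuclideanCLM (𝕜 := ℝ) (CFC.sqrt C⁻¹)).continuous.norm.measurable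

/-- The Lebesgue density of the centered Gaussian measure `𝒩(0, C)`. -/
def gaussianDensity {d : ℕ} (C : Matrix (Fin d) (Fin d) ℝ) (x : E d) : ℝ :=
  (√((2 * Real.pi) ^ d * C.det))⁻¹ * Real.exp (-(normC C x ^ 2) / 2)

theorem measurable_gaussianDensity {d : ℕ} (C : Matrix (Fin d) (Fin d) ℝ) :
    Measurable (gaussianDensity C) :=
  (((measurable_normC C).pow_const 2).neg.div_const 2).exp.const_mul _

/-- The transition kernel of Hit-and-Run with target `𝒩(0, C)`. -/
def gaussianKernel {d : ℕ} (C : Matrix (Fin d) (Fin d) ℝ) : Kernel (E d) (E d) :=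
  kernel (gaussianDensity C) (measurable_gaussianDensity C)

/-- The largest eigenvalue of `C⁻¹`. -/
def maxEig {d : ℕ} (C : Matrix (Fin d) (Fin d) ℝ) : ℝ := sSup (spectrum ℝ C⁻¹)

/-- The smallest eigenvalue of `C⁻¹`. -/
def minEig {d : ℕ} (C : Matrix (Fin d) (Fin d) ℝ) : ℝ := sInf (spectrum ℝ C⁻¹)

/-- The condition number of `C⁻¹`. -/
def cond {d : ℕ} (C : Matrix (Fin d) (Fin d) ℝ) : ℝ := maxEig C / minEig C

/-- The total variation distance of two probability measures, normalized as the total variation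
norm of the difference, `2 sup_A |η(A) - ν(A)|`. This is the normalization for which the constant
in Pinsker's inequality `TV ≤ √2 H^{1/2}` is sharp; bounds on it also bound
`sup_A |η(A) - ν(A)|`. -/
def tv {d : ℕ} (η ν : Measure (E d)) : ℝ≥0∞ :=
  2 * ⨆ (A : Set (E d)) (_ : MeasurableSet A), ENNReal.ofReal |η.real A - ν.real A|

/-- The `L²`-Wasserstein distance (possibly infinite) with respect to the norm `normC C`. -/
def wasserstein {d : ℕ} (C : Matrix (Fin d) (Fin d) ℝ) (η ν : Measure (E d)) : ℝ≥0∞ :=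
  (⨅ (P : Measure (E d × E d)) (_ : P.map Prod.fst = η ∧ P.map Prod.snd = ν),
    ∫⁻ p, ENNReal.ofReal (normC C (p.1 - p.2) ^ 2) ∂P) ^ (1 / 2 : ℝ)

/-- The function `C₁` of the overlap bound. -/
def C₁ {d : ℕ} (C : Matrix (Fin d) (Fin d) ℝ) (ε : ℝ) (x : E d) : ℝ :=
  ε⁻¹ * (√(minEig C))⁻¹ * normC C x + 2 * ε * √(maxEig C) + 1

/-- The function `C₂` of the overlap bound. -/
def C₂ {d : ℕ} (C : Matrix (Fin d) (Fin d) ℝ) (ε : ℝ) (x : E d) : ℝ :=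
  2 * ε⁻¹ * (√(minEig C))⁻¹ * normC C x ^ 2 + 2 * normC C x
    + (ε⁻¹ * (√(minEig C))⁻¹ + 2 * ε * √(cond C)) * ((d : ℝ) - 1)
    + 2 * ε⁻¹ * (√(minEig C))⁻¹
    + (√(maxEig C) + (√(minEig C))⁻¹ + 2) * √(cond C)

/-- The function `C₃` of the overlap bound. -/
def C₃ {d : ℕ} (C : Matrix (Fin d) (Fin d) ℝ) (ε : ℝ) (x : E d) : ℝ :=
  √3 * maxEig C ^ (1 / 4 : ℝ) * normC C x
    + √2 * √(1 + Real.log ε⁻¹) * maxEig C ^ (1 / 4 : ℝ) * √((d : ℝ) - 1)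
    + √2 * maxEig C ^ (1 / 4 : ℝ) * √(√(maxEig C) + (√(minEig C))⁻¹ + 2)

end HitAndRun

end

/-! Write `M`, `m` for the extreme eigenvalues of `C⁻¹` and `r` for the `C^{-1/2}`-distance of two
starting points `x`, `x'`. The kernel from `x` has a Lebesgue density, known explicitly in polar
coordinates around `x` (`gaussianKernel_eq_lintegral`). It is singular at `x`, but a ball of radius
`ρ` around `x` has mass at most `√M * ρ` (`gaussianKernel_ball_le`). Away from such a ball the
densities from `x` and `x'` have a ratio controlled by `exp (-logRatio ..)`
(`exp_neg_mul_stepDensity_le`). Since `1 - exp (-B) ≤ B`, the two kernels differ on any set by at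
most a mass of order `ε` plus a quadratic polynomial in `r` vanishing at `r = 0`, with coefficients
depending on `x` only (`gaussianKernel_le_add`).

The square roots in the bound come from `min 1 u ≤ √u`. Integrating against a coupling, with
Cauchy-Schwarz and Jensen, gives the bound with the transport cost in place of the squared
Wasserstein distance (`bind_le_add_overlapBound`).

It remains to take the infimum over couplings. The bound is continuous in the cost wherever the
infimum is nonzero (`overlapBound_iInf`). At cost zero an infinite coefficient could break
continuity, because `0 * ∞ = 0`; but then `η = ν` (`eq_of_iInf_cost_eq_zero`) and the left-hand side
vanishes. -/

namespace HitAndRun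

/-! ### Comparison of the Euclidean norm with the `C^{-1/2}`-norm. -/

section Spectral

variable {d : ℕ} {C : Matrix (Fin d) (Fin d) ℝ}

theorem normC_sq (hC : C.PosDef) (x : E d) :
    normC C x ^ 2 = inner ℝ x (Matrix.toEuclideanCLM (𝕜 := ℝ) C⁻¹ x) := by
  have h0 : 0 ≤ C⁻¹ := hC.inv.posSemidef.nonneg
  have hs : IsSelfAdjoint (Matrix.toEuclideanCLM (𝕜 := ℝ) (CFC.sqrt C⁻¹)) :=
    (IsSelfAdjoint.of_nonneg (CFC.sqrt_nonneg C⁻¹)).map _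
  have h2 : C⁻¹ = CFC.sqrt C⁻¹ * CFC.sqrt C⁻¹ := (CFC.sqrt_mul_sqrt_self _ h0).symm
  conv_rhs => rw [h2, map_mul]
  rw [normC, ← real_inner_self_eq_norm_sq]
  conv_lhs => rw [← ContinuousLinearMap.adjoint_inner_right, ← ContinuousLinearMap.star_eq_adjoint,
    hs.star_eq]
  rfl

theorem spectrum_inv_finite (C : Matrix (Fin d) (Fin d) ℝ) : (spectrum ℝ C⁻¹).Finite :=
  Matrix.finite_real_spectrum

theorem spectrum_inv_nonempty (hd : 1 ≤ d) (hC : C.PosDef) : (spectrum ℝ C⁻¹).Nonempty := by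
  have : Nonempty (Fin d) := ⟨⟨0, hd⟩⟩
  have h := hC.inv.isHermitian
  exact ⟨_, h.eigenvalues_mem_spectrum_real ⟨0, hd⟩⟩

theorem minEig_pos (hd : 1 ≤ d) (hC : C.PosDef) : 0 < minEig C := by
  have h := (spectrum_inv_nonempty hd hC).csInf_mem (spectrum_inv_finite C)
  rw [minEig]
  generalize sInf (spectrum ℝ C⁻¹) = m at h
  rw [hC.inv.isHermitian.spectrum_real_eq_range_eigenvalues] at h
  obtain ⟨i, rfl⟩ := h
  exact hC.inv.eigenvalues_pos i

theorem minEig_mul_le (hC : C.PosDef) (x : E d) :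
    minEig C * ‖x‖ ^ 2 ≤ normC C x ^ 2 := by
  have h : algebraMap ℝ _ (minEig C) ≤ C⁻¹ :=
    (algebraMap_le_iff_le_spectrum hC.inv.isHermitian).2
      fun y hy => csInf_le (spectrum_inv_finite C).bddBelow hy
  have h1 := (Matrix.nonneg_iff_posSemidef.1 (sub_nonneg.2 h)).dotProduct_mulVec_nonneg x.ofLp
  rw [normC_sq hC, Matrix.inner_toEuclideanCLM]
  rw [Matrix.sub_mulVec, dotProduct_sub, Algebra.algebraMap_eq_smul_one, Matrix.smul_mulVec,
    Matrix.one_mulVec, dotProduct_smul] at h1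
  have h2 : ‖x‖ ^ 2 = x.ofLp ⬝ᵥ x.ofLp := by
    rw [EuclideanSpace.real_norm_sq_eq]; simp [dotProduct, sq]
  simp only [star_trivial, smul_eq_mul] at h1
  rw [h2]; linarith

theorem le_maxEig_mul (hC : C.PosDef) (x : E d) :
    normC C x ^ 2 ≤ maxEig C * ‖x‖ ^ 2 := by
  have h : C⁻¹ ≤ algebraMap ℝ _ (maxEig C) :=
    (le_algebraMap_iff_spectrum_le hC.inv.isHermitian).2
      fun y hy => le_csSup (spectrum_inv_finite C).bddAbove hy
  have h1 := (Matrix.nonneg_iff_posSemidef.1 (sub_nonneg.2 h)).dotProduct_mulVec_nonneg x.ofLp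
  rw [normC_sq hC, Matrix.inner_toEuclideanCLM]
  rw [Matrix.sub_mulVec, dotProduct_sub, Algebra.algebraMap_eq_smul_one, Matrix.smul_mulVec,
    Matrix.one_mulVec, dotProduct_smul] at h1
  have h2 : ‖x‖ ^ 2 = x.ofLp ⬝ᵥ x.ofLp := by
    rw [EuclideanSpace.real_norm_sq_eq]; simp [dotProduct, sq]
  simp only [star_trivial, smul_eq_mul] at h1
  rw [h2]; linarith

theorem minEig_le_maxEig (hd : 1 ≤ d) (hC : C.PosDef) : minEig C ≤ maxEig C :=
  csInf_le_csSup (spectrum_inv_nonempty hd hC) (spectrum_inv_finite C).bddBelow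
    (spectrum_inv_finite C).bddAbove

theorem sqrt_minEig_mul_le (hC : C.PosDef) (x : E d) :
    √(minEig C) * ‖x‖ ≤ normC C x := by
  rw [← Real.sqrt_sq (norm_nonneg x), ← Real.sqrt_mul' _ (sq_nonneg _)]
  exact Real.sqrt_le_iff.2 ⟨norm_nonneg _, minEig_mul_le hC x⟩

theorem le_sqrt_maxEig_mul (hC : C.PosDef) (x : E d) :
    normC C x ≤ √(maxEig C) * ‖x‖ := by
  rw [← Real.sqrt_sq (norm_nonneg x), ← Real.sqrt_mul' _ (sq_nonneg _)]
  exact Real.le_sqrt_of_sq_le (le_maxEig_mul hC x)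

end Spectral

/-! ### Distance from the origin to a line, and Gaussian integrals along lines. -/

section Line

variable {F : Type*} [NormedAddCommGroup F] [InnerProductSpace ℝ F]

/-- The squared distance from the origin to the line `a + ℝ b`. -/
noncomputable def perpSq (a b : F) : ℝ := ‖a‖ ^ 2 - inner ℝ a b ^ 2 / ‖b‖ ^ 2

theorem norm_add_smul_sq {b : F} (hb : b ≠ 0) (a : F) (s : ℝ) :
    ‖a + s • b‖ ^ 2 = ‖b‖ ^ 2 * (s + inner ℝ a b / ‖b‖ ^ 2) ^ 2 + perpSq a b := by
  have : ‖b‖ ≠ 0 := norm_ne_zero_iff.2 hb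
  rw [norm_add_sq_real, norm_smul, inner_smul_right, mul_pow, Real.norm_eq_abs, sq_abs, perpSq]
  field_simp
  ring

theorem perpSq_le {b : F} (hb : b ≠ 0) (a : F) (s : ℝ) : perpSq a b ≤ ‖a + s • b‖ ^ 2 := by
  rw [norm_add_smul_sq hb]
  nlinarith [sq_nonneg (‖b‖ * (s + inner ℝ a b / ‖b‖ ^ 2))]

theorem perpSq_smul (a b : F) {t : ℝ} (ht : t ≠ 0) : perpSq a (t • b) = perpSq a b := by
  rw [perpSq, perpSq, norm_smul, inner_smul_right, mul_pow, mul_pow, Real.norm_eq_abs, sq_abs,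
    mul_div_mul_left _ _ (pow_ne_zero 2 ht)]

/-- Both lines pass through `b`. The foot of the perpendicular on the line through `a'` is carried
to the point with the same parameter on the line through `a`, which moves it by at most `K`. So the
distances `N`, `n` to the origin satisfy `N - n ≤ K`, and if `n < N` then `N ^ 2 - n ^ 2 = (N - n) *
(N + n) ≤ K * (2 * ‖a‖)`, since `n ≤ N ≤ ‖a‖`. -/
theorem perpSq_sub_perpSq_le {a a' b : F} (h : b - a ≠ 0) (h' : b - a' ≠ 0) :
    perpSq a (b - a) - perpSq a' (b - a') ≤
      2 * (‖a‖ * (‖a - a'‖ * (1 + ‖a'‖ / ‖b - a'‖))) := by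
  set w := b - a' with hw
  have hw0 : 0 < ‖w‖ := norm_pos_iff.2 h'
  -- The parameter of the point of the line `a' + ℝ w` closest to the origin.
  set t : ℝ := -(inner ℝ a' w / ‖w‖ ^ 2) with ht
  have h1 : perpSq a' w = ‖a' + t • w‖ ^ 2 := by
    rw [norm_add_smul_sq h', ht]; simp
  have h2 : perpSq a (b - a) ≤ ‖a + t • (b - a)‖ ^ 2 := perpSq_le h a t
  have h3 : perpSq a (b - a) ≤ ‖a‖ ^ 2 := by simpa using perpSq_le h a 0
  have h4 : a + t • (b - a) = (a' + t • w) + (1 - t) • (a - a') := by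
    rw [hw]; module
  have h5 : |t| ≤ ‖a'‖ / ‖w‖ := by
    rw [ht, abs_neg, abs_div, abs_of_nonneg (sq_nonneg ‖w‖), div_le_div_iff₀ (by positivity) hw0]
    nlinarith [abs_real_inner_le_norm a' w]
  have h6 : ‖a + t • (b - a)‖ ≤ ‖a' + t • w‖ + (1 + ‖a'‖ / ‖w‖) * ‖a - a'‖ := by
    rw [h4]
    refine (norm_add_le _ _).trans ?_
    rw [norm_smul]
    gcongr
    refine (norm_sub_le _ _).trans ?_
    simpa using h5
  set K := (1 + ‖a'‖ / ‖w‖) * ‖a - a'‖ with hK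
  have hK0 : 0 ≤ K := by positivity
  rw [show ‖a‖ * (‖a - a'‖ * (1 + ‖a'‖ / ‖w‖)) = ‖a‖ * K by rw [hK]; ring]
  rw [h1]
  rcases le_or_gt (perpSq a (b - a)) (‖a' + t • w‖ ^ 2) with h7 | h7
  · have := mul_nonneg (norm_nonneg a) hK0
    linarith
  · have h0 : 0 ≤ perpSq a (b - a) := (sq_nonneg _).trans h7.le
    set N := √(perpSq a (b - a)) with hN
    have hNs : N ^ 2 = perpSq a (b - a) := Real.sq_sqrt h0
    have hN0 : 0 ≤ N := Real.sqrt_nonneg _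
    have e1 : N ≤ ‖a‖ := Real.sqrt_le_iff.2 ⟨norm_nonneg _, h3⟩
    have e2 : N ≤ ‖a' + t • w‖ + K := (Real.sqrt_le_iff.2 ⟨norm_nonneg _, h2⟩).trans h6
    have e3 : ‖a' + t • w‖ ≤ N := Real.le_sqrt_of_sq_le h7.le
    rw [← hNs]
    have := norm_nonneg (a' + t • w)
    nlinarith [mul_nonneg (sub_nonneg.2 e1) hK0]

theorem lintegral_exp_neg_norm_add_smul_sq {b : F} (hb : b ≠ 0) (a : F) :
    ∫⁻ s : ℝ, ENNReal.ofReal (Real.exp (-(‖a + s • b‖ ^ 2) / 2)) =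
      ENNReal.ofReal (√(2 * Real.pi) / ‖b‖ * Real.exp (-(perpSq a b) / 2)) := by
  have hb0 : 0 < ‖b‖ := norm_pos_iff.2 hb
  have h1 : ∀ s : ℝ, Real.exp (-(‖a + s • b‖ ^ 2) / 2) =
      Real.exp (-(‖b‖ ^ 2 / 2) * (s + inner ℝ a b / ‖b‖ ^ 2) ^ 2)
        * Real.exp (-(perpSq a b) / 2) := by
    intro s
    rw [← Real.exp_add, norm_add_smul_sq hb]
    congr 1; ring
  simp_rw [h1]
  have hi : Integrable fun s : ℝ =>
      Real.exp (-(‖b‖ ^ 2 / 2) * (s + inner ℝ a b / ‖b‖ ^ 2) ^ 2) :=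
    (integrable_exp_neg_mul_sq (b := ‖b‖ ^ 2 / 2) (by positivity)).comp_add_right _
  rw [← ofReal_integral_eq_lintegral_ofReal (hi.mul_const _) (.of_forall fun s => by positivity),
    integral_mul_const,
    integral_add_right_eq_self (fun s : ℝ => Real.exp (-(‖b‖ ^ 2 / 2) * s ^ 2)),
    integral_gaussian]
  congr 3
  rw [show Real.pi / (‖b‖ ^ 2 / 2) = 2 * Real.pi / ‖b‖ ^ 2 by field_simp,
    Real.sqrt_div (by positivity), Real.sqrt_sq hb0.le]

end Line

/-! ### Polar coordinates and the uniform distribution on the sphere. -/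

section Polar

variable {d : ℕ}

theorem lintegral_eq_lintegral_sphere {F : E d → ℝ≥0∞} (hd : 1 ≤ d) (hF : Measurable F) :
    ∫⁻ z, F z = ∫⁻ v : S d, (∫⁻ h in Set.Ioi (0 : ℝ),
      ENNReal.ofReal (h ^ (d - 1)) * F (h • (v : E d))) ∂(volume : Measure (E d)).toSphere := by
  have : Nonempty (Fin d) := ⟨⟨0, hd⟩⟩
  have hmp := (volume : Measure (E d)).measurePreserving_homeomorphUnitSphereProd
  have hG : Measurable fun p : S d × Set.Ioi (0 : ℝ) => F ((p.2 : ℝ) • (p.1 : E d)) :=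
    hF.comp (by fun_prop)
  have h1 := hmp.lintegral_comp hG
  have h2 : ∫⁻ z, F z = ∫⁻ z : ({0}ᶜ : Set (E d)), F z ∂(volume : Measure (E d)).comap (↑) := by
    rw [lintegral_subtype_comap (measurableSet_singleton _).compl, restrict_compl_singleton]
  have h3 : ∀ z : ({0}ᶜ : Set (E d)),
      F (((homeomorphUnitSphereProd (E d) z).2 : ℝ) • ((homeomorphUnitSphereProd (E d) z).1 : E d))
        = F z := by
    intro z
    have hz : (z : E d) ≠ 0 := z.2
    simp [smul_smul, hz]
  simp_rw [h3] at h1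
  rw [h2, h1, lintegral_prod _ hG.aemeasurable]
  refine lintegral_congr fun v => ?_
  have hGv : Measurable fun h : Set.Ioi (0 : ℝ) => F ((h : ℝ) • (v : E d)) := hF.comp (by fun_prop)
  rw [Measure.volumeIoiPow, lintegral_withDensity_eq_lintegral_mul _ (by fun_prop) hGv]
  simp only [Pi.mul_apply, finrank_euclideanSpace, Fintype.card_fin]
  exact lintegral_subtype_comap measurableSet_Ioi
    fun h : ℝ => ENNReal.ofReal (h ^ (d - 1)) * F (h • (v : E d))

/-- When `h` runs over the whole line, every nonzero point is reached twice, as `h • v` and as `(-h)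
• (-v)`; hence the factor 2. -/
theorem lintegral_add_lintegral_neg {F : E d → ℝ≥0∞} (hd : 1 ≤ d) (hF : Measurable F) :
    2 * ∫⁻ z, F z = ∫⁻ v : S d, (∫⁻ h : ℝ,
      ENNReal.ofReal (|h| ^ (d - 1)) * F (h • (v : E d))) ∂(volume : Measure (E d)).toSphere := by
  have hsplit : ∀ G : ℝ → ℝ≥0∞,
      ∫⁻ h, G h = (∫⁻ h in Set.Ioi (0 : ℝ), G h) + ∫⁻ h in Set.Ioi (0 : ℝ), G (-h) := by
    intro G
    have h1 : ∫⁻ h in Set.Ioi (0 : ℝ), G (-h) = ∫⁻ h in Set.Iio (0 : ℝ), G h := by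
      rw [← lintegral_indicator measurableSet_Ioi, ← lintegral_indicator measurableSet_Iio,
        ← lintegral_neg_eq_self]
      refine lintegral_congr fun h => ?_
      by_cases hh : h < 0 <;> simp [Set.indicator, hh]
    rw [h1, ← lintegral_add_compl G (measurableSet_Ioi (a := (0 : ℝ))), Set.compl_Ioi,
      setLIntegral_congr Iio_ae_eq_Iic]
  have hneg : ∫⁻ z, F z = ∫⁻ z, F (-z) := (lintegral_neg_eq_self F).symm
  rw [two_mul]
  nth_rw 2 [hneg]
  rw [lintegral_eq_lintegral_sphere hd hF, lintegral_eq_lintegral_sphere hd (F := fun z => F (-z))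
      (hF.comp measurable_neg),
    ← lintegral_add_left]
  · refine lintegral_congr fun v => ?_
    rw [hsplit]
    congr 1 <;> refine setLIntegral_congr_fun measurableSet_Ioi fun h (hh : 0 < h) => ?_
    · simp [abs_of_pos hh]
    · simp [abs_of_pos hh]
  · refine Measurable.lintegral_prod_right' (f := fun p : S d × ℝ =>
      ENNReal.ofReal (p.2 ^ (d - 1)) * F (p.2 • (p.1 : E d))) ?_
    exact Measurable.mul (by fun_prop) (hF.comp (by fun_prop))

theorem toSphere_univ_ne_zero (hd : 1 ≤ d) :
    (volume : Measure (E d)).toSphere Set.univ ≠ 0 := by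
  have : Nonempty (Fin d) := ⟨⟨0, hd⟩⟩
  exact Measure.measure_univ_ne_zero.2 (Measure.toSphere_ne_zero _)

theorem isProbabilityMeasure_unifSphere (hd : 1 ≤ d) : IsProbabilityMeasure (unifSphere d) := by
  refine ⟨?_⟩
  rw [unifSphere, Measure.smul_apply, smul_eq_mul,
    ENNReal.inv_mul_cancel (toSphere_univ_ne_zero hd) (measure_ne_top _ _)]

end Polar

/-! ### The Hit-and-Run kernel and its Lebesgue density. -/

section Kernel

variable {d : ℕ} {C : Matrix (Fin d) (Fin d) ℝ}

/-- The linear map `C^{-1/2}`. -/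
noncomputable abbrev whiten (C : Matrix (Fin d) (Fin d) ℝ) : E d →L[ℝ] E d :=
  Matrix.toEuclideanCLM (𝕜 := ℝ) (CFC.sqrt C⁻¹)

theorem norm_whiten (x : E d) : ‖whiten C x‖ = normC C x := rfl

theorem whiten_ne_zero (hd : 1 ≤ d) (hC : C.PosDef) {v : E d} (hv : v ≠ 0) :
    whiten C v ≠ 0 := by
  rw [← norm_pos_iff]
  exact (mul_pos (Real.sqrt_pos.2 (minEig_pos hd hC)) (norm_pos_iff.2 hv)).trans_le
    (sqrt_minEig_mul_le hC v)

/-- The density of the displacement `h` of a Hit-and-Run step from `x` in the direction `v`. -/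
noncomputable def lineDensity (C : Matrix (Fin d) (Fin d) ℝ) (x v : E d) (h : ℝ) : ℝ :=
  normC C v / √(2 * Real.pi) *
    Real.exp (-(normC C (x + h • v) ^ 2 - perpSq (whiten C x) (whiten C v)) / 2)

theorem gaussianDensity_div_lintegral (hd : 1 ≤ d) (hC : C.PosDef) (x : E d) {v : E d}
    (hv : v ≠ 0) (h : ℝ) :
    ENNReal.ofReal (gaussianDensity C (x + h • v)) /
      ∫⁻ s : ℝ, ENNReal.ofReal (gaussianDensity C (x + s • v)) =
        ENNReal.ofReal (lineDensity C x v h) := by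
  have hTv := whiten_ne_zero hd hC hv
  have hTv0 : 0 < normC C v := norm_pos_iff.2 hTv
  have hdet := hC.det_pos
  set c := (√((2 * Real.pi) ^ d * C.det))⁻¹ with hc
  have hc0 : 0 < c := by positivity
  have h1 : ∀ s : ℝ, ENNReal.ofReal (gaussianDensity C (x + s • v)) = ENNReal.ofReal c *
      ENNReal.ofReal (Real.exp (-(‖whiten C x + s • whiten C v‖ ^ 2) / 2)) := by
    intro s
    rw [gaussianDensity, ← hc, ENNReal.ofReal_mul hc0.le, ← norm_whiten, map_add, map_smul]
  simp_rw [h1]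
  rw [lintegral_const_mul' _ _ ENNReal.ofReal_ne_top, lintegral_exp_neg_norm_add_smul_sq hTv,
    ← ENNReal.ofReal_mul hc0.le, ← ENNReal.ofReal_mul hc0.le, norm_whiten,
    ← ENNReal.ofReal_div_of_pos (by positivity), mul_div_mul_left _ _ hc0.ne', lineDensity,
    ← norm_whiten (x + h • v), map_add, map_smul]
  congr 1
  rw [show ∀ a p : ℝ, -(a - p) / 2 = -a / 2 - -p / 2 by intros; ring, Real.exp_sub]
  field_simp

theorem lineLaw_apply (hd : 1 ≤ d) (hC : C.PosDef) (x : E d) {v : E d} (hv : v ≠ 0)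
    {A : Set (E d)} (hA : MeasurableSet A) :
    lineLaw (gaussianDensity C) x v A =
      ∫⁻ h : ℝ in (fun h : ℝ => x + h • v) ⁻¹' A, ENNReal.ofReal (lineDensity C x v h) := by
  have hm : Measurable fun h : ℝ => x + h • v := by fun_prop
  rw [lineLaw, Measure.map_apply hm hA, displacement, withDensity_apply _ (hm hA)]
  simp_rw [gaussianDensity_div_lintegral hd hC x hv]

theorem lineLaw_univ (hd : 1 ≤ d) (hC : C.PosDef) (x : E d) {v : E d} (hv : v ≠ 0) :
    lineLaw (gaussianDensity C) x v Set.univ = 1 := by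
  have hTv := whiten_ne_zero hd hC hv
  have hTv0 : 0 < normC C v := norm_pos_iff.2 hTv
  rw [lineLaw_apply hd hC x hv .univ, Set.preimage_univ, setLIntegral_univ]
  set p := perpSq (whiten C x) (whiten C v) with hp
  have h1 : ∀ h : ℝ, ENNReal.ofReal (lineDensity C x v h) =
      ENNReal.ofReal (normC C v / √(2 * Real.pi) * Real.exp (p / 2)) *
      ENNReal.ofReal (Real.exp (-(‖whiten C x + h • whiten C v‖ ^ 2) / 2)) := by
    intro h
    rw [← ENNReal.ofReal_mul (by positivity), lineDensity, ← hp, mul_assoc, ← Real.exp_add,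
      ← norm_whiten (x + h • v), map_add, map_smul]
    congr 3; ring
  simp_rw [h1]
  rw [lintegral_const_mul' _ _ ENNReal.ofReal_ne_top, lintegral_exp_neg_norm_add_smul_sq hTv,
    ← ENNReal.ofReal_mul (by positivity), ← hp, norm_whiten, neg_div, Real.exp_neg]
  simp only [ENNReal.ofReal_eq_one]
  field_simp

theorem gaussianKernel_apply (x : E d) {A : Set (E d)} (hA : MeasurableSet A) :
    gaussianKernel C x A = ∫⁻ v, lineLaw (gaussianDensity C) x v A ∂unifSphere d :=
  Measure.bind_apply hA
    ((measurable_lineLaw (measurable_gaussianDensity C)).comp measurable_prodMk_left).aemeasurable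

theorem sphere_ne_zero (v : S d) : (v : E d) ≠ 0 := ne_zero_of_mem_unit_sphere v

theorem isMarkovKernel_gaussianKernel (hd : 1 ≤ d) (hC : C.PosDef) :
    IsMarkovKernel (gaussianKernel C) := by
  have := isProbabilityMeasure_unifSphere hd
  refine ⟨fun x => ⟨?_⟩⟩
  rw [gaussianKernel_apply x .univ]
  simp_rw [lineLaw_univ hd hC x (sphere_ne_zero _)]
  simp

theorem lineDensity_le (hd : 1 ≤ d) (hC : C.PosDef) (x : E d) {v : E d} (hv : v ≠ 0) (h : ℝ) :
    lineDensity C x v h ≤ normC C v / 2 := by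
  have h2 : (2 : ℝ) ≤ √(2 * Real.pi) := Real.le_sqrt_of_sq_le (by linarith [Real.two_le_pi])
  have h3 := perpSq_le (whiten_ne_zero hd hC hv) (whiten C x) h
  rw [← map_smul, ← map_add, norm_whiten] at h3
  have h4 : Real.exp (-(normC C (x + h • v) ^ 2 - perpSq (whiten C x) (whiten C v)) / 2) ≤ 1 :=
    Real.exp_le_one_iff.2 (by linarith)
  have h0 : 0 ≤ normC C v := norm_nonneg _
  rw [lineDensity, ← mul_one (normC C v / 2)]
  gcongr

/-- In each unit direction the ball cuts out an interval of length `2 * ρ`, on which the line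
density is at most `√(maxEig C) / 2`. -/
theorem gaussianKernel_ball_le (hd : 1 ≤ d) (hC : C.PosDef) (x : E d) (ρ : ℝ) :
    gaussianKernel C x (Metric.ball x ρ) ≤ ENNReal.ofReal (√(maxEig C) * ρ) := by
  have := isProbabilityMeasure_unifSphere hd
  rw [gaussianKernel_apply x measurableSet_ball]
  have key : ∀ v : S d, lineLaw (gaussianDensity C) x v (Metric.ball x ρ) ≤
      ENNReal.ofReal (√(maxEig C) * ρ) := by
    intro v
    have hv : ‖(v : E d)‖ = 1 := by simp
    have hset : (fun h : ℝ => x + h • (v : E d)) ⁻¹' Metric.ball x ρ = Set.Ioo (-ρ) ρ := by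
      ext h
      simp [norm_smul, hv, abs_lt]
    rw [lineLaw_apply hd hC x (sphere_ne_zero v) measurableSet_ball, hset]
    calc ∫⁻ h in Set.Ioo (-ρ) ρ, ENNReal.ofReal (lineDensity C x v h)
        ≤ ∫⁻ _ in Set.Ioo (-ρ) ρ, ENNReal.ofReal (√(maxEig C) / 2) := by
          refine lintegral_mono fun h => ENNReal.ofReal_le_ofReal ?_
          refine (lineDensity_le hd hC x (sphere_ne_zero v) h).trans ?_
          have := le_sqrt_maxEig_mul hC (v : E d)
          rw [hv] at this
          linarith
      _ = ENNReal.ofReal (√(maxEig C) * ρ) := by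
          rw [lintegral_const, Measure.restrict_apply_univ, Real.volume_Ioo,
            ← ENNReal.ofReal_mul (by positivity)]
          congr 1; ring
  calc _ ≤ ∫⁻ _, ENNReal.ofReal (√(maxEig C) * ρ) ∂unifSphere d := lintegral_mono key
    _ = _ := by simp

/-- The transition density of Hit-and-Run with respect to Lebesgue measure, up to a constant
factor. -/
noncomputable def stepDensity (C : Matrix (Fin d) (Fin d) ℝ) (x y : E d) : ℝ :=
  (‖y - x‖ ^ d)⁻¹ * (normC C (y - x) / √(2 * Real.pi) *
    Real.exp (-(normC C y ^ 2 - perpSq (whiten C x) (whiten C (y - x))) / 2))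

theorem measurable_stepDensity (x : E d) : Measurable (stepDensity C x) := by
  unfold stepDensity perpSq
  have h := measurable_normC C
  have h' : Measurable fun y => normC C (y - x) := h.comp (by fun_prop)
  fun_prop

/-- The polar Jacobian accounts for the power `d - 1` of `‖y - x‖`. The remaining power arises
because `normC C (y - x)` in `stepDensity` is `|h|` times `normC C v`. -/
theorem lineDensity_eq_stepDensity (hd : 1 ≤ d) (x : E d) (v : S d) {h : ℝ} (hh : h ≠ 0) :
    |h| ^ (d - 1) * stepDensity C x (x + h • (v : E d)) = lineDensity C x v h := by
  have hv : ‖(v : E d)‖ = 1 := by simp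
  obtain ⟨n, rfl⟩ : ∃ n, d = n + 1 := ⟨d - 1, by omega⟩
  have h1 : normC C (h • (v : E (n + 1))) = |h| * normC C v := by
    rw [normC, map_smul, norm_smul, Real.norm_eq_abs]; rfl
  rw [stepDensity, lineDensity, add_sub_cancel_left, map_smul, perpSq_smul _ _ hh, norm_smul, hv,
    h1, Real.norm_eq_abs]
  have := abs_pos.2 hh
  rw [Nat.add_sub_cancel]
  field_simp
  ring

theorem gaussianKernel_eq_lintegral (hd : 1 ≤ d) (hC : C.PosDef) (x : E d) {A : Set (E d)}
    (hA : MeasurableSet A) :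
    gaussianKernel C x A = ((volume : Measure (E d)).toSphere Set.univ)⁻¹ *
      (2 * ∫⁻ y in A, ENNReal.ofReal (stepDensity C x y)) := by
  have hs := (measurable_stepDensity (C := C) x).ennreal_ofReal
  have hm : Measurable fun z : E d => x + z := by fun_prop
  rw [← lintegral_indicator hA, ← lintegral_add_left_eq_self _ x,
    lintegral_add_lintegral_neg hd (F := fun z =>
      A.indicator (fun y => ENNReal.ofReal (stepDensity C x y)) (x + z))
      ((hs.indicator hA).comp hm), gaussianKernel_apply x hA,
    unifSphere, lintegral_smul_measure, smul_eq_mul]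
  congr 1
  refine lintegral_congr fun v => ?_
  have hm' : Measurable fun h : ℝ => x + h • (v : E d) := by fun_prop
  rw [lineLaw_apply hd hC x (sphere_ne_zero v) hA, ← lintegral_indicator (hm' hA)]
  refine lintegral_congr_ae ?_
  -- At `h = 0` the point is `x` itself, where `stepDensity` takes a junk value.
  have h0 : ∀ᵐ h : ℝ, h ≠ 0 := by simp [ae_iff]
  filter_upwards [h0] with h hh
  by_cases h1 : x + h • (v : E d) ∈ A
  · simp only [Set.indicator, Set.mem_preimage, h1, if_true]
    rw [← ENNReal.ofReal_mul (by positivity), lineDensity_eq_stepDensity hd x v hh]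
  · simp [Set.indicator, h1]

end Kernel

/-! ### Comparison of the kernels started from two points. -/

section Comparison

variable {d : ℕ} {C : Matrix (Fin d) (Fin d) ℝ}

theorem normC_nonneg (C : Matrix (Fin d) (Fin d) ℝ) (x : E d) : 0 ≤ normC C x := norm_nonneg _

/-- The bound on the logarithm of the ratio of the transition densities from `x` and from a point
at distance `r`, outside of a neighbourhood of radius of order `δ`. -/
noncomputable def logRatio (C : Matrix (Fin d) (Fin d) ℝ) (δ : ℝ) (x : E d) (r : ℝ) : ℝ :=
  (d + 1) * (r / (√(minEig C) * δ)) +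
    normC C x * (r * (1 + (normC C x + r) / (√(minEig C) * δ)))

theorem logRatio_nonneg {δ : ℝ} (hδ : 0 ≤ δ) (x : E d) {r : ℝ} (hr : 0 ≤ r) :
    0 ≤ logRatio C δ x r := by
  have := normC_nonneg C x
  unfold logRatio
  positivity

/-- By `hy`, both starting points are at distance at least `δ` from `y`. With `t = r / (√m * δ)`,
moving from `x` to `x'` then changes each of the two norms of the displacement by a factor at most
`1 + t ≤ exp t`. The three factors of `stepDensity` thus cost `d * t`, `t` and, by
`perpSq_sub_perpSq_le`, `b` in the exponent. -/
theorem exp_neg_mul_stepDensity_le (hd : 1 ≤ d) (hC : C.PosDef) {δ : ℝ} (hδ : 0 < δ)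
    {x x' y : E d} (hy : δ + ‖x - x'‖ ≤ ‖y - x‖) :
    Real.exp (-logRatio C δ x (normC C (x - x'))) * stepDensity C x y ≤ stepDensity C x' y := by
  set m := √(minEig C) with hm
  have hm0 : 0 < m := Real.sqrt_pos.2 (minEig_pos hd hC)
  set r := normC C (x - x') with hr
  have hr0 : 0 ≤ r := normC_nonneg C _
  set t := r / (m * δ) with ht
  have ht0 : 0 ≤ t := by positivity
  have hrt : r = m * δ * t := by rw [ht]; field_simp
  have hr' : ‖x - x'‖ ≤ δ * t := by
    have := sqrt_minEig_mul_le hC (x - x')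
    rw [← hm, ← hr, hrt, mul_assoc] at this
    exact le_of_mul_le_mul_left this hm0
  have hexp : 1 + t ≤ Real.exp t := by linarith [Real.add_one_le_exp t]
  have hu : δ ≤ ‖y - x‖ := by linarith [norm_nonneg (x - x')]
  have hu' : δ ≤ ‖y - x'‖ := by
    have := norm_sub_le (y - x') (x - x')
    rw [sub_sub_sub_cancel_right] at this
    linarith
  have huu' : ‖y - x'‖ ≤ ‖y - x‖ * Real.exp t := by
    have h1 := norm_add_le (y - x) (x - x')
    rw [sub_add_sub_cancel] at h1
    nlinarith
  have hN' : m * δ ≤ normC C (y - x') :=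
    (by gcongr : m * δ ≤ m * ‖y - x'‖).trans (sqrt_minEig_mul_le hC _)
  have hN'0 : 0 < normC C (y - x') := (by positivity : 0 < m * δ).trans_le hN'
  have hNN' : normC C (y - x) ≤ normC C (y - x') * Real.exp t := by
    have h1 := norm_sub_le (whiten C (y - x')) (whiten C (x - x'))
    rw [← map_sub, sub_sub_sub_cancel_right, norm_whiten, norm_whiten, norm_whiten] at h1
    nlinarith
  -- This removes `x'` from the estimate, so that the constants can later be integrated against `η`
  -- alone. The extra `r` produces the quadratic term, hence the `normC C x` term of `C₁`.
  have hx' : normC C x' ≤ normC C x + r := by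
    have h1 := norm_sub_le (whiten C x) (whiten C (x - x'))
    rwa [← map_sub, sub_sub_cancel, norm_whiten, norm_whiten, norm_whiten] at h1
  have hyx : whiten C (y - x) ≠ 0 :=
    whiten_ne_zero hd hC (norm_pos_iff.1 (hδ.trans_le hu))
  have hyx' : whiten C (y - x') ≠ 0 :=
    whiten_ne_zero hd hC (norm_pos_iff.1 (hδ.trans_le hu'))
  have hperp : perpSq (whiten C x) (whiten C (y - x)) - perpSq (whiten C x') (whiten C (y - x')) ≤
      2 * (normC C x * (r * (1 + (normC C x + r) / (m * δ)))) := by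
    have h1 := perpSq_sub_perpSq_le (a := whiten C x) (a' := whiten C x') (b := whiten C y)
      (by rwa [← map_sub]) (by rwa [← map_sub])
    simp only [← map_sub, norm_whiten] at h1
    refine h1.trans ?_
    have := normC_nonneg C x
    have := normC_nonneg C x'
    gcongr
  set b := normC C x * (r * (1 + (normC C x + r) / (m * δ))) with hb
  have hB : logRatio C δ x r = d * t + t + b := by
    rw [logRatio, ← hm, ← ht, ← hb]; ring
  rw [hB, stepDensity, stepDensity, neg_add, neg_add, Real.exp_add, Real.exp_add]
  have e1 : Real.exp (-(d * t)) * (‖y - x‖ ^ d)⁻¹ ≤ (‖y - x'‖ ^ d)⁻¹ := by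
    rw [Real.exp_neg, ← mul_inv, Real.exp_nat_mul, ← mul_pow]
    have : 0 < ‖y - x'‖ := hδ.trans_le hu'
    have h2 : ‖y - x'‖ ≤ Real.exp t * ‖y - x‖ := by rwa [mul_comm]
    gcongr
  have e2 : Real.exp (-t) * (normC C (y - x) / √(2 * Real.pi)) ≤
      normC C (y - x') / √(2 * Real.pi) := by
    rw [← mul_div_assoc]
    gcongr
    rw [Real.exp_neg, inv_mul_le_iff₀ (Real.exp_pos t), mul_comm]
    exact hNN'
  have e3 : Real.exp (-b) *
      Real.exp (-(normC C y ^ 2 - perpSq (whiten C x) (whiten C (y - x))) / 2) ≤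
      Real.exp (-(normC C y ^ 2 - perpSq (whiten C x') (whiten C (y - x'))) / 2) := by
    rw [← Real.exp_add]
    exact Real.exp_le_exp.2 (by linarith)
  have p2 : 0 ≤ normC C (y - x) / √(2 * Real.pi) :=
    div_nonneg (normC_nonneg C _) (Real.sqrt_nonneg _)
  have p3 : 0 ≤ (‖y - x'‖ ^ d)⁻¹ := by positivity
  have p4 := div_nonneg hN'0.le (Real.sqrt_nonneg (2 * Real.pi))
  have h := mul_le_mul e1 (mul_le_mul e2 e3
    (mul_nonneg (Real.exp_pos _).le (Real.exp_pos _).le) p4)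
    (mul_nonneg (mul_nonneg (Real.exp_pos _).le p2)
      (mul_nonneg (Real.exp_pos _).le (Real.exp_pos _).le)) p3
  refine le_of_eq_of_le ?_ h
  ring

theorem gaussianKernel_le_add (hd : 1 ≤ d) (hC : C.PosDef) {δ : ℝ} (hδ : 0 < δ) (x x' : E d)
    {A : Set (E d)} (hA : MeasurableSet A) :
    gaussianKernel C x A ≤ gaussianKernel C x' A +
      ENNReal.ofReal (√(maxEig C) * (δ + ‖x - x'‖) + logRatio C δ x (normC C (x - x'))) := by
  have := isMarkovKernel_gaussianKernel hd hC
  set ρ := δ + ‖x - x'‖ with hρ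
  set B := logRatio C δ x (normC C (x - x')) with hB
  have hB0 : 0 ≤ B := logRatio_nonneg hδ.le x (normC_nonneg C _)
  have hA' : MeasurableSet (A \ Metric.ball x ρ) := hA.diff measurableSet_ball
  have h1 : ENNReal.ofReal (Real.exp (-B)) * gaussianKernel C x (A \ Metric.ball x ρ) ≤
      gaussianKernel C x' A := by
    refine le_trans ?_ (measure_mono (Set.sdiff_subset (s := A) (t := Metric.ball x ρ)))
    rw [gaussianKernel_eq_lintegral hd hC x hA', gaussianKernel_eq_lintegral hd hC x' hA',
      mul_left_comm, mul_left_comm _ 2, ← lintegral_const_mul' _ _ ENNReal.ofReal_ne_top]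
    gcongr _ * (2 * ?_)
    refine setLIntegral_mono (measurable_stepDensity x').ennreal_ofReal fun y hy => ?_
    rw [← ENNReal.ofReal_mul (Real.exp_pos _).le]
    refine ENNReal.ofReal_le_ofReal (exp_neg_mul_stepDensity_le hd hC hδ ?_)
    have := hy.2
    rwa [Metric.mem_ball, not_lt, dist_eq_norm] at this
  have h2 : gaussianKernel C x (A \ Metric.ball x ρ) ≤
      gaussianKernel C x' A + ENNReal.ofReal B := by
    calc gaussianKernel C x (A \ Metric.ball x ρ)
        = 1 * gaussianKernel C x (A \ Metric.ball x ρ) := (one_mul _).symm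
      _ ≤ (ENNReal.ofReal (Real.exp (-B)) + ENNReal.ofReal B) *
          gaussianKernel C x (A \ Metric.ball x ρ) := by
          gcongr
          -- `1 ≤ exp (-B) + B` turns the multiplicative comparison into an additive one.
          rw [← ENNReal.ofReal_add (Real.exp_pos _).le hB0, ← ENNReal.ofReal_one]
          exact ENNReal.ofReal_le_ofReal (by linarith [Real.add_one_le_exp (-B)])
      _ ≤ gaussianKernel C x' A + ENNReal.ofReal B * 1 := by
          rw [add_mul]
          gcongr
          exact prob_le_one
      _ = _ := by rw [mul_one]
  calc gaussianKernel C x A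
      ≤ gaussianKernel C x (Metric.ball x ρ) + gaussianKernel C x (A \ Metric.ball x ρ) := by
        refine (measure_mono ?_).trans (measure_union_le _ _)
        intro y hy
        by_cases h : y ∈ Metric.ball x ρ
        · exact Or.inl h
        · exact Or.inr ⟨hy, h⟩
    _ ≤ ENNReal.ofReal (√(maxEig C) * ρ) + (gaussianKernel C x' A + ENNReal.ofReal B) :=
        add_le_add (gaussianKernel_ball_le hd hC x ρ) h2
    _ = _ := by
        rw [ENNReal.ofReal_add (by positivity) hB0]
        ring

end Comparison

/-! ### The pointwise overlap bound with the constants `C₁`, `C₂`, `C₃`. -/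

section Pointwise

variable {d : ℕ} {C : Matrix (Fin d) (Fin d) ℝ}

theorem measurable_C₁ (ε : ℝ) : Measurable (C₁ C ε) := by
  have := measurable_normC C
  unfold C₁; fun_prop

theorem measurable_C₂ (ε : ℝ) : Measurable (C₂ C ε) := by
  have := measurable_normC C
  unfold C₂; fun_prop

theorem measurable_C₃ (ε : ℝ) : Measurable (C₃ C ε) := by
  have := measurable_normC C
  unfold C₃; fun_prop

theorem C₁_nonneg {ε : ℝ} (hε : 0 < ε) (x : E d) : 0 ≤ C₁ C ε x := by
  have := normC_nonneg C x
  unfold C₁; positivity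

theorem C₂_nonneg (hd : 1 ≤ d) {ε : ℝ} (hε : 0 < ε) (x : E d) : 0 ≤ C₂ C ε x := by
  have := normC_nonneg C x
  have : 0 ≤ (d : ℝ) - 1 := by simpa using (by exact_mod_cast hd : (1 : ℝ) ≤ d)
  unfold C₂; positivity

theorem le_C₃ (hM : 0 ≤ maxEig C) (ε : ℝ) (x : E d) : 2 * √√(maxEig C) ≤ C₃ C ε x := by
  have hx := normC_nonneg C x
  have h4 : maxEig C ^ (1 / 4 : ℝ) = √√(maxEig C) := by
    rw [Real.sqrt_eq_rpow, Real.sqrt_eq_rpow, ← Real.rpow_mul hM]; norm_num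
  have h2 : √2 ≤ √(√(maxEig C) + (√(minEig C))⁻¹ + 2) :=
    Real.sqrt_le_sqrt (by
      linarith [Real.sqrt_nonneg (maxEig C), inv_nonneg.2 (Real.sqrt_nonneg (minEig C))])
  have h22 : √2 * √2 = (2 : ℝ) := Real.mul_self_sqrt (by norm_num)
  rw [C₃, h4]
  set a := √√(maxEig C) with ha
  have ha0 : 0 ≤ a := Real.sqrt_nonneg _
  have h1 : 2 * a ≤ √2 * a * √(√(maxEig C) + (√(minEig C))⁻¹ + 2) := by
    calc 2 * a = √2 * a * √2 := by linear_combination -a * h22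
      _ ≤ _ := by gcongr
  have h3 : 0 ≤ √3 * a * normC C x +
      √2 * √(1 + Real.log ε⁻¹) * a * √((d : ℝ) - 1) := by positivity
  linarith

/-- The radius `2 * ε` makes the coefficients `ε⁻¹ * (√m)⁻¹` come out exactly. The factor `d + 1` of
`logRatio` splits as `(d - 1) + 2`, and the term in `‖z‖` is absorbed by `2 * √(cond C)` in `C₂`. -/
theorem two_mul_logRatio_le (hd : 1 ≤ d) (hC : C.PosDef) {ε : ℝ} (hε : 0 < ε) (x z : E d) :
    2 * (√(maxEig C) * ‖z‖ + logRatio C (2 * ε) x (normC C z)) ≤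
      C₁ C ε x * normC C z ^ 2 + C₂ C ε x * normC C z := by
  have hm0 : 0 < √(minEig C) := Real.sqrt_pos.2 (minEig_pos hd hC)
  have hκ : √(cond C) = √(maxEig C) * (√(minEig C))⁻¹ := by
    rw [cond, Real.sqrt_div' _ (minEig_pos hd hC).le, div_eq_mul_inv]
  have hz : ‖z‖ ≤ (√(minEig C))⁻¹ * normC C z := by
    rw [le_inv_mul_iff₀ hm0]; exact sqrt_minEig_mul_le hC z
  have hd' : 0 ≤ (d : ℝ) - 1 := by simpa using (by exact_mod_cast hd : (1 : ℝ) ≤ d)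
  have hx := normC_nonneg C x
  have hr := normC_nonneg C z
  have hMz : √(maxEig C) * ‖z‖ ≤ √(cond C) * normC C z := by
    rw [hκ, mul_assoc]; gcongr
  have hM := Real.sqrt_nonneg (maxEig C)
  have hκ0 := Real.sqrt_nonneg (cond C)
  have hlog : 2 * logRatio C (2 * ε) x (normC C z) =
      normC C z * (ε⁻¹ * (√(minEig C))⁻¹ * (d + 1) + 2 * normC C x
        + ε⁻¹ * (√(minEig C))⁻¹ * normC C x ^ 2)
      + ε⁻¹ * (√(minEig C))⁻¹ * normC C x * normC C z ^ 2 := by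
    rw [logRatio]
    field_simp
    ring
  have hmi : 0 ≤ (√(minEig C))⁻¹ := inv_nonneg.2 hm0.le
  have hεi : 0 ≤ ε⁻¹ := inv_nonneg.2 hε.le
  rw [mul_add, hlog, C₁, C₂]
  clear hlog
  generalize (√(minEig C))⁻¹ = m at *
  generalize √(maxEig C) = M at *
  generalize √(cond C) = k at *
  generalize normC C x = a at *
  generalize normC C z = r at *
  -- The parts of `C₁` and `C₂` that the estimate leaves over.
  have hrest : 0 ≤ (2 * ε * M + 1) * r ^ 2 + r * (ε⁻¹ * m * a ^ 2
      + 2 * ε * k * (d - 1) + (M + m) * k) := by positivity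
  linarith

/-- `min 1 u ≤ √u`, followed by subadditivity of the square root. -/
theorem two_mul_min_one_le {s t a b c : ℝ} (hs : 0 ≤ s) (ht : 0 ≤ t) (ha : 0 ≤ a) (hb : 0 ≤ b)
    (hsc : 2 * s ≤ c) {r : ℝ} (hr : 0 ≤ r) (htr : 2 * t ≤ a * r ^ 2 + b * r) :
    2 * min 1 (s + t) ≤ √2 * (√a * r + √b * √r + √c) := by
  have hc : 0 ≤ c := by linarith
  have h1 : min 1 (s + t) ≤ √(s + t) := by
    rcases le_total (s + t) 1 with h | h
    · rw [min_eq_right h]; exact Real.le_sqrt_of_sq_le (by nlinarith)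
    · rw [min_eq_left h]; exact Real.one_le_sqrt.2 h
  have h2 : ∀ u v : ℝ, 0 ≤ u → 0 ≤ v → √(u + v) ≤ √u + √v := fun u v hu hv =>
    Real.sqrt_le_iff.2 ⟨by positivity, by
      nlinarith [Real.sq_sqrt hu, Real.sq_sqrt hv, Real.sqrt_nonneg u, Real.sqrt_nonneg v]⟩
  have h3 : √2 * √(2 * (s + t)) = 2 * √(s + t) := by
    rw [Real.sqrt_mul zero_le_two, ← mul_assoc, Real.mul_self_sqrt zero_le_two]
  have h4 : √(a * r ^ 2) = √a * r := by rw [Real.sqrt_mul ha, Real.sqrt_sq hr]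
  have h5 : √(b * r) = √b * √r := Real.sqrt_mul hb r
  calc 2 * min 1 (s + t) ≤ √2 * √(2 * (s + t)) := by linarith
    _ ≤ √2 * √(c + (a * r ^ 2 + b * r)) := by
        gcongr; linarith
    _ ≤ √2 * (√c + (√(a * r ^ 2) + √(b * r))) := by
        gcongr
        exact (h2 _ _ (by positivity) (by positivity)).trans
          (by gcongr; exact h2 _ _ (by positivity) (by positivity))
    _ = _ := by rw [h4, h5]; ring

theorem gaussianKernel_le_add_overlap (hd : 1 ≤ d) (hC : C.PosDef) {ε : ℝ} (hε : 0 < ε)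
    (x x' : E d) {A : Set (E d)} (hA : MeasurableSet A) :
    gaussianKernel C x A ≤ gaussianKernel C x' A +
      ENNReal.ofReal (√2 / 2 * (√(C₁ C ε x) * normC C (x - x') + √(C₂ C ε x) * √(normC C (x - x'))
        + C₃ C ε x * √ε)) := by
  have := isMarkovKernel_gaussianKernel hd hC
  have hM : 0 ≤ maxEig C := (minEig_pos hd hC).le.trans (minEig_le_maxEig hd hC)
  have h2 := le_C₃ hM ε x
  have hC₃ : 0 ≤ C₃ C ε x := le_trans (by positivity) h2
  have hr := normC_nonneg C (x - x')
  -- Here `s` is the ball bound for the radius `2 * ε`, and `c` is chosen so that `√c` is the `C₃`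
  -- term; `2 * s ≤ c` follows from `le_C₃`.
  have h3 := two_mul_min_one_le (s := 2 * √(maxEig C) * ε)
    (t := √(maxEig C) * ‖x - x'‖ + logRatio C (2 * ε) x (normC C (x - x')))
    (c := (C₃ C ε x * √ε) ^ 2) (by positivity)
    (add_nonneg (by positivity) (logRatio_nonneg (by positivity) x hr)) (C₁_nonneg hε x)
    (C₂_nonneg hd hε x) ?_ hr (two_mul_logRatio_le hd hC hε x (x - x'))
  · rw [Real.sqrt_sq (by positivity)] at h3
    set Q := √2 * (√(C₁ C ε x) * normC C (x - x') + √(C₂ C ε x) * √(normC C (x - x'))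
        + C₃ C ε x * √ε)
    calc gaussianKernel C x A ≤ gaussianKernel C x' A + ENNReal.ofReal (min 1
          (2 * √(maxEig C) * ε
            + (√(maxEig C) * ‖x - x'‖ + logRatio C (2 * ε) x (normC C (x - x'))))) := by
          rw [ENNReal.ofReal_mono.map_min, ← min_add_add_left]
          refine le_min (prob_le_one.trans (by simp)) ?_
          refine (gaussianKernel_le_add hd hC (by positivity : 0 < 2 * ε) x x' hA).trans ?_
          gcongr _ + ENNReal.ofReal ?_
          exact le_of_eq (by ring)
      _ ≤ _ := by
          gcongr
          rw [div_mul_eq_mul_div]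
          linarith
  · rw [mul_pow, Real.sq_sqrt hε.le]
    have h4 : (2 * √√(maxEig C)) ^ 2 ≤ C₃ C ε x ^ 2 := by gcongr
    rw [mul_pow, Real.sq_sqrt (Real.sqrt_nonneg _)] at h4
    nlinarith

end Pointwise

/-! ### Integration over couplings and passage to the Wasserstein distance. -/

section Coupling

variable {d : ℕ} {C : Matrix (Fin d) (Fin d) ℝ}

theorem lintegral_sqrt_mul_sqrt_le {α : Type*} [MeasurableSpace α] (μ : Measure α)
    {f g : α → ℝ≥0∞} (hf : Measurable f) (hg : Measurable g) :
    ∫⁻ a, f a ^ (1 / 2 : ℝ) * g a ^ (1 / 2 : ℝ) ∂μ ≤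
      (∫⁻ a, f a ∂μ) ^ (1 / 2 : ℝ) * (∫⁻ a, g a ∂μ) ^ (1 / 2 : ℝ) := by
  have h := ENNReal.lintegral_mul_le_Lp_mul_Lq μ Real.HolderConjugate.two_two
    (hf.pow_const (1 / 2 : ℝ)).aemeasurable (hg.pow_const (1 / 2 : ℝ)).aemeasurable
  have h2 : ∀ x : ℝ≥0∞, (x ^ (1 / 2 : ℝ)) ^ (2 : ℝ) = x := fun x => by
    rw [← ENNReal.rpow_mul]; norm_num
  simp_rw [h2] at h
  exact h

theorem lintegral_sqrt_le {α : Type*} [MeasurableSpace α] (μ : Measure α) [IsProbabilityMeasure μ]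
    {g : α → ℝ≥0∞} (hg : Measurable g) :
    ∫⁻ a, g a ^ (1 / 2 : ℝ) ∂μ ≤ (∫⁻ a, g a ∂μ) ^ (1 / 2 : ℝ) := by
  simpa using lintegral_sqrt_mul_sqrt_le μ (measurable_one (α := ℝ≥0∞) (β := α)) hg

/-- The cost of a coupling for the squared distance with respect to `normC C`. -/
noncomputable def cost (C : Matrix (Fin d) (Fin d) ℝ) (P : Measure (E d × E d)) : ℝ≥0∞ :=
  ∫⁻ p, ENNReal.ofReal (normC C (p.1 - p.2) ^ 2) ∂P

theorem measurable_cost_integrand :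
    Measurable fun p : E d × E d => ENNReal.ofReal (normC C (p.1 - p.2) ^ 2) :=
  (((measurable_normC C).comp (by fun_prop)).pow_const 2).ennreal_ofReal

/-- The overlap bound as a function of the transport cost. -/
noncomputable def overlapBound (C : Matrix (Fin d) (Fin d) ℝ) (ε : ℝ) (η : Measure (E d))
    (w : ℝ≥0∞) : ℝ≥0∞ :=
  (∫⁻ x, ENNReal.ofReal (C₁ C ε x) ∂η) ^ (1 / 2 : ℝ) * w ^ (1 / 2 : ℝ)
    + (∫⁻ x, ENNReal.ofReal (C₂ C ε x) ∂η) ^ (1 / 2 : ℝ) * (w ^ (1 / 2 : ℝ)) ^ (1 / 2 : ℝ)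
    + (∫⁻ x, ENNReal.ofReal (C₃ C ε x) ∂η) * ENNReal.ofReal (ε ^ (1 / 2 : ℝ))

theorem bind_le_add_overlapBound (hd : 1 ≤ d) (hC : C.PosDef) {ε : ℝ} (hε : 0 < ε)
    {η ν : Measure (E d)} [IsProbabilityMeasure η] {P : Measure (E d × E d)}
    (hη : P.map Prod.fst = η) (hν : P.map Prod.snd = ν) {A : Set (E d)} (hA : MeasurableSet A) :
    η.bind (gaussianKernel C) A ≤ ν.bind (gaussianKernel C) A +
      ENNReal.ofReal (√2 / 2) * overlapBound C ε η (cost C P) := by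
  have hP : IsProbabilityMeasure P := by
    constructor
    rw [← Set.preimage_univ (f := Prod.fst), ← Measure.map_apply measurable_fst .univ, hη,
      measure_univ]
  have hk : Measurable fun x => gaussianKernel C x A := Kernel.measurable_coe _ hA
  have hk' : Measurable fun p : E d × E d => gaussianKernel C p.2 A := hk.comp measurable_snd
  have hM : 0 ≤ maxEig C := (minEig_pos hd hC).le.trans (minEig_le_maxEig hd hC)
  have h₁ := (measurable_C₁ (C := C) ε).ennreal_ofReal
  have h₂ := (measurable_C₂ (C := C) ε).ennreal_ofReal
  have h₃ := (measurable_C₃ (C := C) ε).ennreal_ofReal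
  have h₁' : Measurable fun p : E d × E d => ENNReal.ofReal (C₁ C ε p.1) :=
    h₁.comp measurable_fst
  have h₂' : Measurable fun p : E d × E d => ENNReal.ofReal (C₂ C ε p.1) :=
    h₂.comp measurable_fst
  have h₃' : Measurable fun p : E d × E d => ENNReal.ofReal (C₃ C ε p.1) :=
    h₃.comp measurable_fst
  have hg := measurable_cost_integrand (C := C)
  have h₁g : Measurable fun p : E d × E d => ENNReal.ofReal (C₁ C ε p.1) ^ (1 / 2 : ℝ)
      * ENNReal.ofReal (normC C (p.1 - p.2) ^ 2) ^ (1 / 2 : ℝ) :=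
    (h₁'.pow_const _).mul (hg.pow_const _)
  have eη : ∀ {f : E d → ℝ≥0∞}, Measurable f → ∫⁻ x, f x ∂η = ∫⁻ p, f p.1 ∂P := fun hf => by
    rw [← hη, lintegral_map hf measurable_fst]
  have eν : ∀ {f : E d → ℝ≥0∞}, Measurable f → ∫⁻ x, f x ∂ν = ∫⁻ p, f p.2 ∂P := fun hf => by
    rw [← hν, lintegral_map hf measurable_snd]
  have hpt : ∀ p : E d × E d, gaussianKernel C p.1 A ≤ gaussianKernel C p.2 A +
      ENNReal.ofReal (√2 / 2) *
        (ENNReal.ofReal (C₁ C ε p.1) ^ (1 / 2 : ℝ)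
            * ENNReal.ofReal (normC C (p.1 - p.2) ^ 2) ^ (1 / 2 : ℝ)
          + ENNReal.ofReal (C₂ C ε p.1) ^ (1 / 2 : ℝ)
            * (ENNReal.ofReal (normC C (p.1 - p.2) ^ 2) ^ (1 / 2 : ℝ)) ^ (1 / 2 : ℝ)
          + ENNReal.ofReal (C₃ C ε p.1) * ENNReal.ofReal (ε ^ (1 / 2 : ℝ))) := by
    intro p
    refine (gaussianKernel_le_add_overlap hd hC hε p.1 p.2 hA).trans (le_of_eq ?_)
    have hr := normC_nonneg C (p.1 - p.2)
    have c1 := C₁_nonneg (C := C) hε p.1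
    have c2 := C₂_nonneg (C := C) hd hε p.1
    have c3 : 0 ≤ C₃ C ε p.1 := le_trans (by positivity) (le_C₃ hM ε p.1)
    rw [ENNReal.ofReal_rpow_of_nonneg c1 (by norm_num),
      ENNReal.ofReal_rpow_of_nonneg c2 (by norm_num),
      ENNReal.ofReal_rpow_of_nonneg (sq_nonneg _) (by norm_num), ← Real.sqrt_eq_rpow,
      ← Real.sqrt_eq_rpow, ← Real.sqrt_eq_rpow, ← Real.sqrt_eq_rpow, Real.sqrt_sq hr,
      ENNReal.ofReal_rpow_of_nonneg hr (by norm_num), ← Real.sqrt_eq_rpow,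
      ← ENNReal.ofReal_mul (by positivity), ← ENNReal.ofReal_mul (by positivity),
      ← ENNReal.ofReal_mul c3, ← ENNReal.ofReal_add (by positivity) (by positivity),
      ← ENNReal.ofReal_add (by positivity) (by positivity), ← ENNReal.ofReal_mul (by positivity)]
  rw [Measure.bind_apply hA (gaussianKernel C).aemeasurable,
    Measure.bind_apply hA (gaussianKernel C).aemeasurable, eη hk, eν hk]
  refine (lintegral_mono hpt).trans ?_
  rw [lintegral_add_left hk', lintegral_const_mul' _ _ ENNReal.ofReal_ne_top]
  gcongr
  rw [overlapBound, eη h₁, eη h₂, eη h₃, cost,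
    lintegral_add_right _ (h₃'.mul_const _), lintegral_mul_const _ h₃',
    lintegral_add_left h₁g]
  gcongr
  · exact lintegral_sqrt_mul_sqrt_le P h₁' hg
  -- Cauchy-Schwarz leaves the mean of `r`, and Jensen bounds it by the root of the mean of `r ^ 2`.
  · refine (lintegral_sqrt_mul_sqrt_le P h₂' (hg.pow_const _)).trans ?_
    gcongr
    exact lintegral_sqrt_le P hg

/-- A one-sided bound suffices: applied to the complement of `A` it gives the other side. -/
theorem tv_le_two_mul {μ μ' : Measure (E d)} [IsProbabilityMeasure μ] [IsProbabilityMeasure μ']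
    {X : ℝ≥0∞} (h : ∀ A, MeasurableSet A → μ A ≤ μ' A + X) : tv μ μ' ≤ 2 * X := by
  rcases eq_or_ne X ∞ with rfl | hX
  · simp
  have hreal : ∀ A, MeasurableSet A → μ.real A ≤ μ'.real A + X.toReal := fun A hA => by
    rw [measureReal_def, measureReal_def, ← ENNReal.toReal_add (measure_ne_top _ _) hX]
    exact ENNReal.toReal_mono (ENNReal.add_ne_top.2 ⟨measure_ne_top _ _, hX⟩) (h A hA)
  rw [tv]
  gcongr
  refine iSup₂_le fun A hA => ?_
  rw [ENNReal.ofReal_le_iff_le_toReal hX, abs_le]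
  have h1 := hreal A hA
  have h2 := hreal Aᶜ hA.compl
  rw [probReal_compl_eq_one_sub hA, probReal_compl_eq_one_sub hA] at h2
  constructor <;> linarith

/-- Markov's inequality for the event that the coupled points are at least `e` apart. General `f`,
`g` allow either order of the coordinates, as the Lévy-Prokhorov distance needs both. -/
theorem measure_le_thickening_add {μ μ' : Measure (E d)} (hC : C.PosDef) (hd : 1 ≤ d)
    {P : Measure (E d × E d)} {f g : E d × E d → E d} (hf : Measurable f) (hg : Measurable g)
    (hfg : ∀ p, dist (f p) (g p) = dist p.1 p.2)
    (hμ : P.map f = μ) (hμ' : P.map g = μ') {e : ℝ} (he : 0 < e) {B : Set (E d)}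
    (hB : MeasurableSet B) :
    μ B ≤ μ' (Metric.thickening e B) + cost C P / ENNReal.ofReal (minEig C * e ^ 2) := by
  have hm := minEig_pos hd hC
  rw [← hμ, ← hμ', Measure.map_apply hf hB,
    Measure.map_apply hg Metric.isOpen_thickening.measurableSet]
  calc P (f ⁻¹' B) ≤ P (g ⁻¹' Metric.thickening e B ∪
        {p | ENNReal.ofReal (minEig C * e ^ 2) ≤ ENNReal.ofReal (normC C (p.1 - p.2) ^ 2)}) := by
        refine measure_mono fun p hp => ?_
        by_cases h : dist p.1 p.2 < e
        · refine Or.inl (Metric.mem_thickening_iff.2 ⟨f p, hp, ?_⟩)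
          rwa [dist_comm, hfg]
        · refine Or.inr (ENNReal.ofReal_le_ofReal (le_trans ?_ (minEig_mul_le hC _)))
          rw [not_lt, dist_eq_norm] at h
          gcongr
    _ ≤ _ := (measure_union_le _ _).trans (by
        gcongr
        exact meas_ge_le_lintegral_div measurable_cost_integrand.aemeasurable
          (by simp; positivity) ENNReal.ofReal_ne_top)

/-- No optimal coupling is needed: couplings of arbitrarily small cost force the Lévy-Prokhorov
distance to be zero, so the measures agree on closed sets, which form a generating π-system. -/
theorem eq_of_iInf_cost_eq_zero (hd : 1 ≤ d) (hC : C.PosDef) {η ν : Measure (E d)}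
    [IsProbabilityMeasure η] [IsProbabilityMeasure ν]
    (h : (⨅ P : {P : Measure (E d × E d) // P.map Prod.fst = η ∧ P.map Prod.snd = ν},
      cost C P.1) = 0) : η = ν := by
  have hm := minEig_pos hd hC
  have hLP : levyProkhorovEDist η ν = 0 := by
    refine le_antisymm (levyProkhorovEDist_le_of_forall _ _ _ fun e B he0 heT hB => ?_) zero_le
    have he : 0 < e.toReal := ENNReal.toReal_pos he0.ne' heT.ne
    have hc0 : ENNReal.ofReal (minEig C * e.toReal ^ 2) ≠ 0 := by simp; positivity
    have hpos : 0 < e * ENNReal.ofReal (minEig C * e.toReal ^ 2) := ENNReal.mul_pos he0.ne' hc0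
    obtain ⟨⟨P, hη, hν⟩, hP⟩ := iInf_lt_iff.1 (h.trans_lt hpos)
    have hle : cost C P / ENNReal.ofReal (minEig C * e.toReal ^ 2) ≤ e :=
      ENNReal.div_le_of_le_mul hP.le
    exact ⟨(measure_le_thickening_add hC hd measurable_fst measurable_snd (fun _ => rfl)
        hη hν he hB).trans (by gcongr),
      (measure_le_thickening_add hC hd measurable_snd measurable_fst (fun _ => dist_comm _ _)
        hν hη he hB).trans (by gcongr)⟩
  refine ext_of_generate_finite {s : Set (E d) | IsClosed s}
    (BorelSpace.measurable_eq.trans borel_eq_generateFrom_isClosed) isPiSystem_isClosed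
    (fun s hs => ?_) (by simp)
  exact measure_eq_measure_of_levyProkhorovEDist_eq_zero_of_isClosed hLP hs
    ⟨1, one_pos, measure_ne_top _ _⟩ ⟨1, one_pos, measure_ne_top _ _⟩

theorem wasserstein_eq (η ν : Measure (E d)) :
    wasserstein C η ν =
      (⨅ P : {P : Measure (E d × E d) // P.map Prod.fst = η ∧ P.map Prod.snd = ν},
        cost C P.1) ^ (1 / 2 : ℝ) := by
  rw [wasserstein, iInf_subtype']
  rfl

theorem tv_self (η : Measure (E d)) : tv η η = 0 := by simp [tv]

theorem monotone_overlapBound (ε : ℝ) (η : Measure (E d)) : Monotone (overlapBound C ε η) := by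
  intro w w' h
  unfold overlapBound
  gcongr

/-- A monotone function commutes with an infimum at which it is continuous. Multiplication by a
possibly infinite constant is continuous away from zero, which is where `h0` enters. -/
theorem overlapBound_iInf {ι : Type*} [Nonempty ι] {ε : ℝ} {η : Measure (E d)} (w : ι → ℝ≥0∞)
    (h0 : (⨅ i, w i) ≠ 0) :
    (⨅ i, overlapBound C ε η (w i)) = overlapBound C ε η (⨅ i, w i) := by
  have hc : ContinuousAt (overlapBound C ε η) (⨅ i, w i) := by
    have h1 : ContinuousAt (fun w : ℝ≥0∞ => w ^ (1 / 2 : ℝ)) (⨅ i, w i) :=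
      ENNReal.continuous_rpow_const.continuousAt
    have h2 : ContinuousAt (fun w : ℝ≥0∞ => (w ^ (1 / 2 : ℝ)) ^ (1 / 2 : ℝ)) (⨅ i, w i) :=
      (ENNReal.continuous_rpow_const.comp ENNReal.continuous_rpow_const).continuousAt
    have p1 : (⨅ i, w i) ^ (1 / 2 : ℝ) ≠ 0 := by simpa using h0
    have p2 : ((⨅ i, w i) ^ (1 / 2 : ℝ)) ^ (1 / 2 : ℝ) ≠ 0 := by
      simpa [← ENNReal.rpow_mul] using h0
    exact ((ENNReal.Tendsto.const_mul h1 (Or.inl p1)).add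
      (ENNReal.Tendsto.const_mul h2 (Or.inl p2))).add tendsto_const_nhds
  exact ((monotone_overlapBound ε η).map_ciInf_of_continuousAt hc (OrderBot.bddBelow _)).symm

end Coupling

end HitAndRun

theorem lemma5 (d : ℕ) (hd : 1 ≤ d) (C : Matrix (Fin d) (Fin d) ℝ) (hC : C.PosDef)
    (ε : ℝ) (hε0 : 0 < ε) (hε1 : ε < 1)
    (η ν : Measure (HitAndRun.E d)) [IsProbabilityMeasure η] [IsProbabilityMeasure ν] :
    HitAndRun.tv (η.bind (HitAndRun.gaussianKernel C)) (ν.bind (HitAndRun.gaussianKernel C)) ≤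
      ENNReal.ofReal (√2) *
        ((∫⁻ x, ENNReal.ofReal (HitAndRun.C₁ C ε x) ∂η) ^ (1 / 2 : ℝ)
            * HitAndRun.wasserstein C η ν
          + (∫⁻ x, ENNReal.ofReal (HitAndRun.C₂ C ε x) ∂η) ^ (1 / 2 : ℝ)
            * HitAndRun.wasserstein C η ν ^ (1 / 2 : ℝ)
          + (∫⁻ x, ENNReal.ofReal (HitAndRun.C₃ C ε x) ∂η)
            * ENNReal.ofReal (ε ^ (1 / 2 : ℝ))) := by
  have := HitAndRun.isMarkovKernel_gaussianKernel hd hC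
  rw [HitAndRun.wasserstein_eq]
  by_cases h0 : (⨅ P : {P : Measure (HitAndRun.E d × HitAndRun.E d) //
      P.map Prod.fst = η ∧ P.map Prod.snd = ν}, HitAndRun.cost C P.1) = 0
  · rw [HitAndRun.eq_of_iInf_cost_eq_zero hd hC h0, HitAndRun.tv_self]
    exact zero_le
  have : Nonempty {P : Measure (HitAndRun.E d × HitAndRun.E d) //
      P.map Prod.fst = η ∧ P.map Prod.snd = ν} :=
    ⟨⟨η.prod ν, by simp [Measure.map_fst_prod], by simp [Measure.map_snd_prod]⟩⟩
  change _ ≤ ENNReal.ofReal (√2) * HitAndRun.overlapBound C ε η _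
  rw [← HitAndRun.overlapBound_iInf _ h0, ENNReal.mul_iInf_of_ne (by simp) ENNReal.ofReal_ne_top]
  refine le_iInf fun P => (HitAndRun.tv_le_two_mul fun A hA =>
    HitAndRun.bind_le_add_overlapBound hd hC hε0 P.2.1 P.2.2 hA).trans_eq ?_
  -- The factor 2 is the normalization of `tv`.
  have h2 : 2 * ENNReal.ofReal (√2 / 2) = ENNReal.ofReal √2 := by
    rw [two_mul, ← ENNReal.ofReal_add (by positivity) (by positivity), add_halves]
  rw [← mul_assoc, h2]
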